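/- All graphs are finite and simple. For a graph $G$ let $e(G)$ be its number of edges, $\Delta(G)$ its maximum degree and $\nu(G)$ the maximum number of edges of a matching in $G$; for $S\subseteq V(G)$ let $G[S]$ be the subgraph induced by $S$, let $N_S(v)$ be the set of neighbours of $v$ lying in $S$, and let $d_S(v)=|N_S(v)|$. Let $S_m$ be the star with $m$ edges, let $\ell K_2$ be the graph consisting of $\ell$ disjoint edges, and let $\cup$ between graphs denote disjoint union. Put $f(\nu,\Delta)=\max\{e(H): \nu(H)\le\nu,\ \Delta(H)\le\Delta\}$. Let $G$ be a graph whose vertex set is the disjoint union $V(G)=V_0\cup V_1$. Let $G_0=G[V_0]$ and $G_1=G[V_1]$, and let $G_{cr}$ be the bipartite graph formed by the edges of $G$ between $V_0$ and $V_1$. Let $k\ge 1$ and $0\le k_1\le k$ be integers. Suppose that (1) for $i=0,1$, $G_i$ contains no subgraph (not necessarily induced) isomorphic to $S_{k-\ell}\cup \ell K_2$, for every integer $\ell$ with $0\le \ell\le\min\{k-k_1,k-2\}$ and for $\ell=k-1$; (2) $d_{V_i}(v)+\nu\bigl(G_{1-i}[N_{V_{1-i}}(v)]\bigr)\le k-1$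 for $i=0,1$ and every $v\in V_i$; (3) if $k>k_1$, then for $i=0,1$ and every $v\in V_i$ with $d_{V_i}(v)=k-1$, all vertices of $N_{V_{1-i}}(v)$ are isolated in $G_{1-i}$. Then $$e(G_0)+e(G_1)-\bigl(|V_0||V_1|-e(G_{cr})\bigr)\le\begin{cases}(k-1)^2 & \text{if } k>k_1,\\ f(k-1,k-1) & \text{if } k=k_1.\end{cases}$$ -/

import Mathlib

namespace StarMatching

/-- The star `S_m` with `m` edges, on `m + 1` vertices. -/
def star (m : ℕ) : SimpleGraph (Fin (m + 1)) :=
  SimpleGraph.starGraph 0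

/-- The graph `ℓ K₂`: the disjoint union of `ℓ` edges `{(j, 0), (j, 1)}`, `j < ℓ`. -/
def edges (ℓ : ℕ) : SimpleGraph (Fin ℓ × Fin 2) where
  Adj a b := a.1 = b.1 ∧ a.2 ≠ b.2
  symm := ⟨fun _ _ h => ⟨h.1.symm, h.2.symm⟩⟩
  loopless := ⟨fun _ h => h.2 rfl⟩

/-- The graph `S_m ∪ ℓ K₂` (disjoint union). -/
def starEdges (m ℓ : ℕ) : SimpleGraph (Fin (m + 1) ⊕ Fin ℓ × Fin 2) :=
  SimpleGraph.sum (star m) (edges ℓ)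

/-- The number of edges `e(G)` (of a finite graph). -/
noncomputable def numEdges {V : Type*} (G : SimpleGraph V) : ℕ :=
  G.edgeSet.ncard

/-- The matching number `ν(G)` (of a finite graph): the largest number of edges of a matching. -/
noncomputable def matchingNumber {V : Type*} (G : SimpleGraph V) : ℕ :=
  sSup {m : ℕ | ∃ M : G.Subgraph, M.IsMatching ∧ M.edgeSet.ncard = m}

/-- `N_S(v)`, the set of neighbours of `v` lying in `S`. -/
def nbrs {V : Type*} (G : SimpleGraph V) (S : Set V) (v : V) : Set V :=
  {u | G.Adj v u ∧ u ∈ S}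

/-- `d_S(v) = |N_S(v)|`. -/
noncomputable def deg {V : Type*} (G : SimpleGraph V) (S : Set V) (v : V) : ℕ :=
  (nbrs G S v).ncard

/-- The numbers of edges of the finite graphs `G` with `ν(G) ≤ ν` and `Δ(G) ≤ D`. -/
def sizes (ν D : ℕ) : Set ℕ :=
  {m | ∃ (n : ℕ) (G : SimpleGraph (Fin n)) (_ : DecidableRel G.Adj),
    matchingNumber G ≤ ν ∧ G.maxDegree ≤ D ∧ numEdges G = m}

/-- `f(ν, D) = max {e(G) : ν(G) ≤ ν and Δ(G) ≤ D}`, over all finite graphs `G`. -/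
noncomputable def f (ν D : ℕ) : ℕ :=
  sSup (sizes ν D)

open SimpleGraph in
/-- The maximum defining `ν(G)` exists. -/
theorem matchingNumber_isGreatest {V : Type*} [Finite V] (G : SimpleGraph V) :
    IsGreatest {m : ℕ | ∃ M : G.Subgraph, M.IsMatching ∧ M.edgeSet.ncard = m}
      (matchingNumber G) := by
  have hb : BddAbove {m : ℕ | ∃ M : G.Subgraph, M.IsMatching ∧ M.edgeSet.ncard = m} := by
    refine ⟨G.edgeSet.ncard, ?_⟩
    rintro m ⟨M, -, rfl⟩
    exact Set.ncard_le_ncard M.edgeSet_subset (Set.toFinite _)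
  refine ⟨Nat.sSup_mem ⟨0, ⊥, ?_, by simp⟩ hb, fun m hm => le_csSup hb hm⟩
  intro v hv
  exact absurd hv (by simp)

open SimpleGraph in
/-- A crude bound on `e(G)`, showing that `f` is a maximum of a bounded set. -/
theorem numEdges_le {V : Type*} [Fintype V] (G : SimpleGraph V) [DecidableRel G.Adj] :
    numEdges G ≤ 2 * matchingNumber G * G.maxDegree := by
  classical
  obtain ⟨M, hM, hcard⟩ := (matchingNumber_isGreatest G).1
  have hcov : ∀ x y, G.Adj x y → x ∈ M.verts ∨ y ∈ M.verts := by
    intro x y hxy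
    by_contra! hcon
    have hM' : (M ⊔ G.subgraphOfAdj hxy).IsMatching := by
      refine hM.sup (Subgraph.IsMatching.subgraphOfAdj hxy) ?_
      rw [hM.support_eq_verts, (Subgraph.IsMatching.subgraphOfAdj hxy).support_eq_verts]
      rw [Set.disjoint_left]
      rintro z hz hz'
      rcases hz' with rfl | rfl
      exacts [hcon.1 hz, hcon.2 hz]
    have h := (matchingNumber_isGreatest G).2 ⟨_, hM', rfl⟩
    rw [Subgraph.edgeSet_sup, edgeSet_subgraphOfAdj, Set.union_singleton,
      Set.ncard_insert_of_notMem (fun h' : s(x, y) ∈ M.edgeSet => hcon.1 (M.edge_vert h'))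
        (Set.toFinite _), hcard] at h
    omega
  have hverts : M.verts.toFinset.card ≤ 2 * matchingNumber G := by
    have : M.verts.toFinset ⊆ M.edgeSet.toFinset.biUnion Sym2.toFinset := by
      intro v hv
      obtain ⟨w, hw, -⟩ := hM (Set.mem_toFinset.1 hv)
      simp only [Finset.mem_biUnion, Set.mem_toFinset, Sym2.mem_toFinset]
      exact ⟨s(v, w), hw, by simp⟩
    refine (Finset.card_le_card this).trans ?_
    refine (Finset.card_biUnion_le_card_mul _ _ 2 ?_).trans ?_
    · intro e _
      induction e with | _ a b => ?_
      rw [Sym2.toFinset_mk_eq]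
      exact Finset.card_le_two
    · rw [← hcard, Set.ncard_eq_toFinset_card', mul_comm]
  have hsub : G.edgeFinset ⊆ M.verts.toFinset.biUnion fun v => G.incidenceFinset v := by
    intro e he
    induction e with | _ x y => ?_
    have hxy : G.Adj x y := by simpa using he
    simp only [Finset.mem_biUnion, Set.mem_toFinset, mem_incidenceFinset]
    rcases hcov x y hxy with h | h
    · exact ⟨x, h, hxy, by simp⟩
    · exact ⟨y, h, hxy, by simp⟩
  have h1 : numEdges G = G.edgeFinset.card := by
    rw [numEdges, ← coe_edgeFinset, Set.ncard_coe_finset]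
  rw [h1]
  refine (Finset.card_le_card hsub).trans
    ((Finset.card_biUnion_le_card_mul _ _ G.maxDegree ?_).trans (Nat.mul_le_mul_right _ hverts))
  intro v _
  rw [card_incidenceFinset_eq_degree]
  exact G.degree_le_maxDegree v

/-- The maximum defining `f(ν, D)` exists. -/
theorem f_isGreatest (ν D : ℕ) : IsGreatest (sizes ν D) (f ν D) := by
  have hb : BddAbove (sizes ν D) := by
    refine ⟨2 * ν * D, ?_⟩
    rintro m ⟨n, G, _, h1, h2, rfl⟩
    exact (numEdges_le G).trans (by gcongr)
  refine ⟨Nat.sSup_mem ⟨0, 0, ⊥, inferInstance, ?_, ?_, ?_⟩ hb, fun m hm => le_csSup hb hm⟩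
  · obtain ⟨M, -, h⟩ := (matchingNumber_isGreatest (⊥ : SimpleGraph (Fin 0))).1
    rw [← h, Set.eq_empty_of_isEmpty M.edgeSet]; simp
  · simp
  · simp [numEdges]

end StarMatching

/-!
Write `K = k - 1` and `ν_i = ν(G_i)`. Excluding `S_{k-ℓ} ∪ ℓ K₂` for `ℓ = 0` and `ℓ = k - 1` bounds
all degrees in `G_i` and both `ν_i` by `K`. A vertex `v` of `V_i` with `m(v)` non-neighbours on the
other side satisfies `d(v) + ν_{1-i} ≤ K + m(v)`, because each non-neighbour destroys at most one
edge of a maximum matching of `G_{1-i}` (`matchingNumber_induce_le_add`). The number of missing cross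
edges is the sum of `m(v)` over either side, so it pays for the excess of the degrees over
`K - ν_{1-i}`.

The remaining truncated degrees are controlled by `sum_min_degree_le`: if all degrees are at most `D`
and `b + 2 ≤ D`, then `∑ min (d(x), b) ≤ ν (D + b)`. Its proof deletes vertices covered by every
maximum matching, and when there are none it uses Gallai's lemma (`unmatched_unique_of_reachable`):
a maximum matching misses at most one vertex of each component. With `b = D - 2` for an artificially
large `D` it also yields `e ≤ ν (Δ + 1)`.

If `ν_0, ν_1 ≥ 2`, averaging the estimates of the two sides gives the bound
`K² - (K - ν_0) (K - ν_1)`, and `K² ≤ f(K, K)` by the complete bipartite graph. If one of the `ν_i`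
is at most `1`, then either `ν_0 + ν_1 ≤ K`, where `G_0 ∪ G_1` competes in `f(K, K)`, or the other
matching number equals `K` and the missing edges outnumber the edges of `G_i`. When `k₁ < k`, the
bound `K²` replaces `f(K, K)` because `e(G_i) ≤ ν_i K` as long as all degrees are below `K`. A
vertex `v` of degree `K` is treated apart: by the exclusion of `S_K ∪ K₂` its neighbours cover all
edges on its side, and by hypothesis (3) it has at least `2 ν_{1-i}` non-neighbours
(`numEdges_add_le_sq_add_missing_of_deg_eq`).
-/

namespace StarMatching

open Finset SimpleGraph
open scoped Classical

variable {V : Type*}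

/-! ### Matchings as involutions -/

/-- A matching of `H`, encoded as an involution of the vertex set: matched vertices are exchanged
with their partners, unmatched vertices are fixed. -/
structure IsPairing (H : SimpleGraph V) (σ : V → V) : Prop where
  invol : Function.Involutive σ
  adj : ∀ x, σ x ≠ x → H.Adj x (σ x)

lemma isPairing_id (H : SimpleGraph V) : IsPairing H id :=
  ⟨fun _ => rfl, fun _ h => absurd rfl h⟩

lemma IsPairing.mono {H H' : SimpleGraph V} (h : H ≤ H') {σ : V → V} (hσ : IsPairing H σ) :
    IsPairing H' σ :=
  ⟨hσ.invol, fun x hx => h (hσ.adj x hx)⟩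

/-- The restriction of a pairing to a set of vertices closed under it. -/
lemma IsPairing.restrict {H : SimpleGraph V} {σ : V → V} (hσ : IsPairing H σ) (p : V → Prop)
    [DecidablePred p]
    (hp : ∀ x, p x → p (σ x)) : IsPairing H (fun x => if p x then σ x else x) := by
  refine ⟨fun x => ?_, fun x hx => ?_⟩
  · by_cases h : p x
    · simp [h, hp x h, hσ.invol x]
    · simp [h]
  · by_cases h : p x
    · simp only [h, if_true] at hx ⊢; exact hσ.adj x hx
    · simp [h] at hx

/-- The subgraph formed by the edges of a pairing. -/
def IsPairing.subgraph {H : SimpleGraph V} {σ : V → V} (hσ : IsPairing H σ) : H.Subgraph where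
  verts := {x | σ x ≠ x}
  Adj x y := σ x = y ∧ σ x ≠ x
  adj_sub := by rintro x y ⟨rfl, h⟩; exact hσ.adj x h
  edge_vert := fun h => h.2
  symm := ⟨by
    rintro x y ⟨rfl, h⟩
    exact ⟨hσ.invol x, fun h' => h (by rw [← h', h', ← hσ.invol x, h', h'])⟩⟩

lemma IsPairing.subgraph_isMatching {H : SimpleGraph V} {σ : V → V} (hσ : IsPairing H σ) :
    hσ.subgraph.IsMatching :=
  fun x hx => ⟨σ x, ⟨rfl, hx⟩, fun _ hy => hy.1.symm⟩

variable [Fintype V]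

/-- The set of matched vertices of a pairing. -/
noncomputable def moved (σ : V → V) : Finset V := univ.filter fun x => σ x ≠ x

@[simp] lemma mem_moved {σ : V → V} {x : V} : x ∈ moved σ ↔ σ x ≠ x := by simp [moved]

/-- Two adjacent unmatched vertices can be matched with each other. -/
lemma IsPairing.insert {H : SimpleGraph V} {σ : V → V} (hσ : IsPairing H σ) {x y : V}
    (hxy : H.Adj x y) (hx : σ x = x) (hy : σ y = y) :
    ∃ τ, IsPairing H τ ∧ #(moved σ) < #(moved τ) := by
  have hne := hxy.ne
  have hval : ∀ z, z ≠ x → z ≠ y → σ z ≠ x ∧ σ z ≠ y := fun z h1 h2 =>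
    ⟨fun h => h1 (by rw [← hσ.invol z, h, hx]), fun h => h2 (by rw [← hσ.invol z, h, hy])⟩
  refine ⟨fun z => if z = x then y else if z = y then x else σ z, ⟨fun z => ?_, fun z hz => ?_⟩, ?_⟩
  · by_cases h1 : z = x
    · simp [h1, hne.symm]
    by_cases h2 : z = y
    · simp [h2, hne.symm]
    · simp [h1, h2, hval z h1 h2, hσ.invol z]
  · by_cases h1 : z = x
    · simpa [h1] using hxy
    by_cases h2 : z = y
    · simpa [h2, hne.symm] using hxy.symm
    · simp only [h1, h2, if_false] at hz ⊢; exact hσ.adj z hz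
  · refine card_lt_card (Finset.ssubset_iff_of_subset ?_ |>.2 ⟨x, ?_, ?_⟩)
    · intro z hz
      have h1 : z ≠ x := by rintro rfl; simp [hx] at hz
      have h2 : z ≠ y := by rintro rfl; simp [hy] at hz
      simpa [h1, h2] using hz
    · simp [hne.symm]
    · simp [hx]

/-- A matching covers twice as many vertices as it has edges. -/
lemma ncard_verts_of_isMatching {H : SimpleGraph V} {M : H.Subgraph} (hM : M.IsMatching) :
    M.verts.ncard = 2 * M.edgeSet.ncard := by
  have h := M.spanningCoe.sum_degrees_eq_twice_card_edges
  have hd : ∀ v, M.spanningCoe.degree v = if v ∈ M.verts then 1 else 0 := by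
    intro v
    split_ifs with hv
    · obtain ⟨w, hw, hu⟩ := hM hv
      rw [← card_neighborFinset_eq_degree, card_eq_one]
      exact ⟨w, by ext z; simpa using ⟨hu z, fun h => h ▸ hw⟩⟩
    · rw [← card_neighborFinset_eq_degree, card_eq_zero]
      ext z
      simpa using fun h => hv (M.edge_vert h)
  simp only [hd, sum_boole, Nat.cast_id] at h
  rw [Set.ncard_eq_toFinset_card', Set.ncard_eq_toFinset_card']
  convert h using 2
  · ext; simp
  · congr 1
    ext e
    simp [← Subgraph.edgeSet_spanningCoe]

lemma IsPairing.exists_card {H : SimpleGraph V} {σ : V → V} (hσ : IsPairing H σ) :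
    ∃ m ≤ matchingNumber H, #(moved σ) = 2 * m := by
  refine ⟨_, (matchingNumber_isGreatest H).2 ⟨_, hσ.subgraph_isMatching, rfl⟩, ?_⟩
  rw [← ncard_verts_of_isMatching hσ.subgraph_isMatching, Set.ncard_eq_toFinset_card']
  congr 1
  ext x
  rw [mem_moved, Set.mem_toFinset]
  rfl

lemma IsPairing.card_le {H : SimpleGraph V} {σ : V → V} (hσ : IsPairing H σ) :
    #(moved σ) ≤ 2 * matchingNumber H := by
  obtain ⟨m, hm, h⟩ := hσ.exists_card
  omega

lemma exists_isPairing_card_eq (H : SimpleGraph V) :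
    ∃ σ, IsPairing H σ ∧ #(moved σ) = 2 * matchingNumber H := by
  obtain ⟨M, hM, hc⟩ := (matchingNumber_isGreatest H).1
  have hM' : ∀ x ∈ M.verts, ∃ w, M.Adj x w ∧ ∀ y, M.Adj x y → y = w := fun x hx => hM hx
  choose! g hg hu using hM'
  have hmem : ∀ x ∈ M.verts, g x ∈ M.verts := fun x hx => M.edge_vert (hg x hx).symm
  have hgg : ∀ x ∈ M.verts, g (g x) = x := fun x hx => (hu _ (hmem x hx) _ (hg x hx).symm).symm
  refine ⟨fun x => if x ∈ M.verts then g x else x, ⟨fun x => ?_, fun x hx => ?_⟩, ?_⟩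
  · by_cases h : x ∈ M.verts
    · simp [h, hmem x h, hgg x h]
    · simp [h]
  · by_cases h : x ∈ M.verts
    · simpa [h] using M.adj_sub (hg x h)
    · simp [h] at hx
  · rw [← hc, ← ncard_verts_of_isMatching hM,
      Set.ncard_eq_toFinset_card']
    congr 1
    ext x
    by_cases h : x ∈ M.verts
    · simpa [h] using (M.adj_sub (hg x h)).ne'
    · simp [h]

/-! ### Gallai's lemma and a weighted degree sum -/

/-- The transitivity step of Gallai's lemma: if no maximum pairing leaves both `u` and `w` unmatched
and none leaves both `w` and `v` unmatched, while some maximum pairing leaves `w` unmatched, then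
none leaves both `u` and `v` unmatched. -/
lemma not_both_unmatched_trans {H : SimpleGraph V} {s : ℕ}
    (hmax : ∀ σ, IsPairing H σ → #(moved σ) ≤ s) {u v w : V} (huv : u ≠ v)
    (hw : ∃ τ, IsPairing H τ ∧ #(moved τ) = s ∧ τ w = w)
    (huw : ∀ σ, IsPairing H σ → #(moved σ) = s → σ u = u → σ w ≠ w)
    (hwv : ∀ σ, IsPairing H σ → #(moved σ) = s → σ w = w → σ v ≠ v)
    {σ : V → V} (hσ : IsPairing H σ) (hs : #(moved σ) = s) (hu : σ u = u) : σ v ≠ v := by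
  intro hv
  -- Among the maximum pairings missing `w`, one agreeing with `σ` at most points.
  obtain ⟨τ, hτ, hbest⟩ := Finset.exists_max_image
    (univ.filter fun τ : V → V => IsPairing H τ ∧ #(moved τ) = s ∧ τ w = w)
    (fun τ => #(univ.filter fun x => σ x = τ x)) (by simpa [Finset.Nonempty] using hw)
  simp only [mem_filter, mem_univ, true_and] at hτ hbest
  obtain ⟨hτ, hτs, hτw⟩ := hτ
  have hτu : τ u ≠ u := fun h => huw τ hτ hτs h hτw
  have hτv : τ v ≠ v := hwv τ hτ hτs hτw
  have h2 : 2 ≤ #(moved τ \ moved σ) := by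
    rw [← card_pair huv]
    refine card_le_card fun z hz => ?_
    rcases mem_insert.1 hz with rfl | hz
    · simp [hτu, hu]
    · rw [mem_singleton.1 hz]; simp [hτv, hv]
  have h3 : 1 < #(moved σ \ moved τ) := by
    have e1 := card_sdiff_add_card_inter (moved τ) (moved σ)
    have e2 := card_sdiff_add_card_inter (moved σ) (moved τ)
    rw [inter_comm] at e2
    omega
  obtain ⟨x, hx, hxw⟩ := exists_mem_ne h3 w
  simp only [mem_sdiff, mem_moved, not_not] at hx
  obtain ⟨hσx, hτx⟩ := hx
  set y := σ x with hy
  have hσy : σ y = x := hσ.invol x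
  have hτy : τ y ≠ y := by
    intro h
    obtain ⟨ρ, hρ, hlt⟩ := hτ.insert (hσ.adj x hσx) hτx h
    have := hmax ρ hρ
    omega
  set z := τ y with hz
  have hτz : τ z = y := hτ.invol y
  have hzx : z ≠ x := by
    intro h
    rw [h, hτx] at hτz
    exact hσx hτz.symm
  have hzw : z ≠ w := by
    intro h
    rw [h, hτw] at hτz
    exact hτy (by rw [h, hτz])
  -- Replacing the edge `yz` of `τ` by `xy` increases the agreement.
  set e := Equiv.swap x z
  have hex : e x = z := Equiv.swap_apply_left _ _
  have hez : e z = x := Equiv.swap_apply_right _ _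
  have heo : ∀ t, t ≠ x → t ≠ z → e t = t := fun t h1 h2 => Equiv.swap_apply_of_ne_of_ne h1 h2
  have hee : ∀ t, e (e t) = t := fun t => Equiv.swap_apply_self _ _ t
  have hey : e y = y := heo y hσx hτy.symm
  let ρ : V → V := fun t => e (τ (e t))
  have hρx : ρ x = y := by simp only [ρ, hex, hτz, hey]
  have hρy : ρ y = x := by simp only [ρ, hey, ← hz, hez]
  have hρz : ρ z = z := by simp only [ρ, hez, hτx, hex]
  have hρo : ∀ t, t ≠ x → t ≠ y → t ≠ z → ρ t = τ t := by
    intro t h1 h2 h3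
    simp only [ρ, heo t h1 h3]
    refine heo _ (fun h => h1 ?_) (fun h => h2 ?_)
    · rw [← hτ.invol t, h, hτx]
    · rw [← hτ.invol t, h, hτz]
  have hρ : IsPairing H ρ := by
    refine ⟨fun t => by simp only [ρ, hee, hτ.invol (e t)], fun t ht => ?_⟩
    by_cases h1 : t = x
    · subst h1; rw [hρx]; exact hσ.adj _ hσx
    by_cases h2 : t = y
    · rw [h2, hρy]; exact (hσ.adj _ hσx).symm
    by_cases h3 : t = z
    · exact absurd (h3 ▸ hρz) ht
    · rw [hρo t h1 h2 h3] at ht ⊢; exact hτ.adj t ht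
  have hρs : #(moved ρ) = s := by
    rw [← hτs]
    refine card_bij (fun t _ => e t) (fun t ht => ?_) (fun a _ b _ h => e.injective h)
      (fun t ht => ⟨e t, ?_, hee t⟩)
    · simp only [mem_moved, ρ] at ht ⊢
      exact fun h => ht (by rw [h, hee])
    · simp only [mem_moved, ρ] at ht ⊢
      rw [hee]
      exact fun h => ht (e.injective h)
  have hρw : ρ w = w := by
    simp only [ρ, heo w hxw.symm hzw.symm, hτw]
  refine absurd (hbest ρ ⟨hρ, hρs, hρw⟩) (not_le.2 (card_lt_card
    (Finset.ssubset_iff_of_subset (fun t ht => ?_) |>.2 ⟨x, ?_, ?_⟩)))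
  · simp only [mem_filter, mem_univ, true_and] at ht ⊢
    by_cases h1 : t = x
    · rw [h1, hρx]
    by_cases h2 : t = y
    · rw [h2, hρy, hσy]
    by_cases h3 : t = z
    · rw [h3, hτz] at ht
      exact absurd (by rw [← hσ.invol z, ht, hσy]) hzx
    · rw [hρo t h1 h2 h3, ht]
  · simp [hρx, ← hy]
  · simp only [mem_filter, mem_univ, true_and, hτx]; exact hσx

/-- Gallai's lemma: if every vertex is left unmatched by some maximum pairing, then no maximum
pairing leaves two vertices of the same component unmatched. -/
lemma unmatched_unique_of_reachable {H : SimpleGraph V} {s : ℕ}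
    (hmax : ∀ σ, IsPairing H σ → #(moved σ) ≤ s)
    (hall : ∀ w, ∃ τ, IsPairing H τ ∧ #(moved τ) = s ∧ τ w = w)
    {σ : V → V} (hσ : IsPairing H σ) (hs : #(moved σ) = s) {u v : V} (h : H.Reachable u v)
    (hu : σ u = u) (hv : σ v = v) : u = v := by
  by_contra hne
  have key : ∀ {u v : V} (_ : H.Walk u v), u ≠ v →
      ∀ σ, IsPairing H σ → #(moved σ) = s → σ u = u → σ v ≠ v := by
    intro u v p
    induction p with
    | nil => exact fun h => absurd rfl h
    | @cons u w v huw p ih =>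
      have hadj : ∀ σ, IsPairing H σ → #(moved σ) = s → σ u = u → σ w ≠ w := by
        intro σ hσ hs h1 h2
        obtain ⟨τ, hτ, hlt⟩ := hσ.insert huw h1 h2
        have := hmax τ hτ
        omega
      intro hne σ hσ hs hu
      by_cases hwv : w = v
      · subst hwv; exact hadj σ hσ hs hu
      · exact not_both_unmatched_trans hmax hne (hall w) hadj (ih hwv) hσ hs hu
  obtain ⟨p⟩ := h
  exact key p hne σ hσ hs hu hv

/-- The bound of `sum_min_degree_le` when every vertex is left unmatched by some maximum pairing:
by Gallai's lemma it can be checked on each component separately. -/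
lemma sum_min_degree_le_of_forall_unmatched {H : SimpleGraph V} {D b s : ℕ} (hb : b + 2 ≤ D)
    (hmax : ∀ σ, IsPairing H σ → #(moved σ) ≤ s)
    (hall : ∀ w, ∃ τ, IsPairing H τ ∧ #(moved τ) = s ∧ τ w = w)
    {σ : V → V} (hσ : IsPairing H σ) (hs : #(moved σ) = s) :
    2 * ∑ x, min (H.degree x) b ≤ s * (D + b) := by
  rw [← hs, ← sum_fiberwise univ H.connectedComponentMk,
    card_eq_sum_card_fiberwise (f := H.connectedComponentMk) (t := univ) (fun _ _ => by simp),
    mul_sum, sum_mul]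
  refine sum_le_sum fun C _ => ?_
  set F := univ.filter fun x => H.connectedComponentMk x = C
  set t := #((moved σ).filter fun x => H.connectedComponentMk x = C) with ht
  have hF : #F ≤ t + 1 := by
    rw [← card_filter_add_card_filter_not (s := F) (fun x => σ x ≠ x)]
    refine add_le_add (card_le_card fun x => ?_) (card_le_one.2 fun x hx y hy => ?_)
    · simp only [F, mem_filter, mem_univ, true_and, mem_moved]; tauto
    · simp only [F, mem_filter, mem_univ, true_and, not_not] at hx hy
      exact unmatched_unique_of_reachable hmax hall hσ hs
        (ConnectedComponent.exact (hx.1.trans hy.1.symm)) hx.2 hy.2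
  have hdeg : ∀ x ∈ F, min (H.degree x) b ≤ min t b := by
    intro x hx
    refine min_le_min_right _ ?_
    have hsub : insert x (H.neighborFinset x) ⊆ F := by
      intro y hy
      simp only [F, mem_filter, mem_univ, true_and] at hx ⊢
      rcases mem_insert.1 hy with rfl | hy
      · exact hx
      · rw [← hx]
        exact ConnectedComponent.sound ((H.mem_neighborFinset x y).1 hy).symm.reachable
    have := card_le_card hsub
    rw [card_insert_of_notMem (by simp), card_neighborFinset_eq_degree] at this
    omega
  have h1 : ∑ x ∈ F, min (H.degree x) b ≤ (t + 1) * min t b :=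
    (sum_le_card_nsmul _ _ _ hdeg).trans (Nat.mul_le_mul_right _ hF)
  have h2 : 2 * ((t + 1) * min t b) ≤ t * (D + b) := by
    rcases le_total t b with h | h
    · rw [min_eq_left h]; nlinarith
    · rw [min_eq_right h]; nlinarith
  omega

/-- A degree-sum bound: in a graph with matching number `ν` and degrees at most `D`, the degrees
truncated at `b ≤ D - 2` add up to at most `ν (D + b)`. Deleting a vertex that is matched by every
maximum matching lowers `ν` by one and the sum by at most `D + b`; if there is no such vertex,
every component is factor-critical. -/
theorem sum_min_degree_le {H : SimpleGraph V} {D b : ℕ} (hD : ∀ x, H.degree x ≤ D)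
    (hb : b + 2 ≤ D) : ∑ x, min (H.degree x) b ≤ matchingNumber H * (D + b) := by
  suffices h : ∀ m, ∀ H : SimpleGraph V, (∀ x, H.degree x ≤ D) → matchingNumber H ≤ m →
      ∑ x, min (H.degree x) b ≤ m * (D + b) from h _ H hD le_rfl
  intro m
  induction m with
  | zero =>
    intro H hD hm
    have h0 : ∀ x, H.degree x = 0 := by
      intro x
      by_contra hx
      obtain ⟨y, hy⟩ := (H.degree_pos_iff_exists_adj x).1 (Nat.pos_of_ne_zero hx)
      obtain ⟨τ, hτ, hlt⟩ := (isPairing_id H).insert hy rfl rfl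
      have := hτ.card_le
      omega
    simp [h0]
  | succ m ih =>
    intro H hD hm
    obtain ⟨σ, hσ, hs⟩ := exists_isPairing_card_eq H
    have hmax : ∀ τ, IsPairing H τ → #(moved τ) ≤ 2 * matchingNumber H := fun τ hτ => hτ.card_le
    by_cases hall : ∀ w, ∃ τ, IsPairing H τ ∧ #(moved τ) = 2 * matchingNumber H ∧ τ w = w
    · have := sum_min_degree_le_of_forall_unmatched hb hmax hall hσ hs
      nlinarith [Nat.mul_le_mul_right (D + b) hm]
    push Not at hall
    obtain ⟨w, hw⟩ := hall
    obtain ⟨H', hH'⟩ : ∃ H', H' = H.deleteIncidenceSet w := ⟨_, rfl⟩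
    have hle : H' ≤ H := hH' ▸ H.deleteIncidenceSet_le w
    have hdel : ∀ x, H'.degree x ≤ H.degree x := fun x => degree_le_of_le hle
    have hν : matchingNumber H' ≤ m := by
      obtain ⟨τ, hτ, hτs⟩ := exists_isPairing_card_eq H'
      have hτw : τ w = w := by
        by_contra h
        exact (deleteIncidenceSet_adj.1 (hH' ▸ hτ.adj w h)).2.1 rfl
      have h1 := hmax τ (hτ.mono hle)
      have h2 : #(moved τ) ≠ 2 * matchingNumber H := fun h => hw τ (hτ.mono hle) h hτw
      omega
    have hi := ih H' (fun x => (hdel x).trans (hD x)) hν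
    have hpt : ∀ x, min (H.degree x) b ≤
        min (H'.degree x) b + (if H.Adj w x then 1 else 0) + (if x = w then b else 0) := by
      intro x
      by_cases hxw : x = w
      · simp [hxw]
      have : H.neighborFinset x ⊆ H'.neighborFinset x ∪ if H.Adj w x then {w} else ∅ := by
        intro y hy
        rw [mem_neighborFinset] at hy
        by_cases hyw : y = w
        · subst hyw; simp [hy.symm]
        · simp [hH', deleteIncidenceSet_adj, hy, hxw, hyw]
      have h := (card_le_card this).trans (card_union_le _ _)
      rw [card_neighborFinset_eq_degree, card_neighborFinset_eq_degree] at h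
      split_ifs at h ⊢ <;> simp at h ⊢ <;> omega
    have hsum := sum_le_sum fun x (_ : x ∈ univ) => hpt x
    rw [sum_add_distrib, sum_add_distrib, sum_boole, sum_ite_eq' univ w (fun _ => b)] at hsum
    have hdw : #(univ.filter fun x => H.Adj w x) ≤ D := by
      refine le_trans (le_of_eq ?_) (hD w)
      rw [← card_neighborFinset_eq_degree]
      congr 1; ext; simp
    simp only [mem_univ, if_true, Nat.cast_id] at hsum
    linarith

/-! ### Matchings and degrees in induced subgraphs -/

/-- The subgraph induced on `A`, as a graph on the whole vertex set. -/
def within {V : Type*} (G : SimpleGraph V) (A : Set V) : SimpleGraph V where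
  Adj x y := G.Adj x y ∧ x ∈ A ∧ y ∈ A
  symm := ⟨fun _ _ h => ⟨h.1.symm, h.2.2, h.2.1⟩⟩
  loopless := ⟨fun _ h => h.1.ne rfl⟩

lemma card_moved_le_of_within {G : SimpleGraph V} {A : Set V} {σ : V → V}
    (hσ : IsPairing (within G A) σ) : #(moved σ) ≤ 2 * matchingNumber (G.induce A) := by
  have hA : ∀ x ∈ A, σ x ∈ A := by
    intro x hx
    by_cases h : σ x = x
    · rwa [h]
    · exact (hσ.adj x h).2.2
  let τ : A → A := fun x => ⟨σ x, hA x x.2⟩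
  have hτ : IsPairing (G.induce A) τ :=
    ⟨fun x => Subtype.ext (hσ.invol x), fun x hx => (hσ.adj x fun h => hx (Subtype.ext h)).1⟩
  refine le_trans (le_of_eq ?_) hτ.card_le
  symm
  refine card_bij (fun x _ => (x : V)) (fun x hx => ?_) (fun _ _ _ _ h => Subtype.ext h)
    fun x hx => ?_
  · exact mem_moved.2 fun h => mem_moved.1 hx (Subtype.ext h)
  · rw [mem_moved] at hx
    exact ⟨⟨x, (hσ.adj x hx).2.1⟩, mem_moved.2 fun h => hx (congrArg Subtype.val h), rfl⟩

lemma exists_isPairing_within (G : SimpleGraph V) (A : Set V) :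
    ∃ σ, IsPairing (within G A) σ ∧ #(moved σ) = 2 * matchingNumber (G.induce A) := by
  obtain ⟨τ, hτ, hs⟩ := exists_isPairing_card_eq (G.induce A)
  refine ⟨fun x => if h : x ∈ A then τ ⟨x, h⟩ else x, ⟨fun x => ?_, fun x hx => ?_⟩, ?_⟩
  · by_cases h : x ∈ A
    · simp [h, hτ.invol ⟨x, h⟩]
    · simp [h]
  · by_cases h : x ∈ A
    · simp only [h, dif_pos] at hx ⊢
      exact ⟨hτ.adj ⟨x, h⟩ fun h' => hx (congrArg Subtype.val h'), h, (τ ⟨x, h⟩).2⟩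
    · simp [h] at hx
  · rw [← hs]
    symm
    refine card_bij (fun x _ => (x : V)) (fun x hx => ?_) (fun _ _ _ _ h => Subtype.ext h)
      fun x hx => ?_
    · rw [mem_moved] at hx ⊢
      simpa [Subtype.ext_iff] using hx
    · rw [mem_moved] at hx
      by_cases h : x ∈ A
      · exact ⟨⟨x, h⟩, by simpa [h, Subtype.ext_iff] using hx, rfl⟩
      · simp [h] at hx

lemma deg_eq_card (G : SimpleGraph V) (S : Set V) (x : V) :
    deg G S x = #(univ.filter fun y => G.Adj x y ∧ y ∈ S) := by
  rw [deg, ← Set.ncard_coe_finset]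
  congr 1
  ext y; simp [nbrs]

lemma degree_induce (G : SimpleGraph V) (A : Set V) (x : A) :
    (G.induce A).degree x = deg G A x := by
  rw [deg_eq_card, ← card_neighborFinset_eq_degree]
  refine card_bij (fun y _ => (y : V)) (fun y hy => ?_) (fun _ _ _ _ h => Subtype.ext h)
    fun y hy => ?_
  · simpa using hy
  · have hy' : G.Adj x y ∧ y ∈ A := by simpa using hy
    exact ⟨⟨y, hy'.2⟩, by simpa using hy'.1, rfl⟩

lemma two_mul_numEdges (H : SimpleGraph V) : 2 * numEdges H = ∑ x, H.degree x := by
  rw [H.sum_degrees_eq_twice_card_edges, numEdges, ← coe_edgeFinset, Set.ncard_coe_finset]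

lemma two_mul_numEdges_induce (G : SimpleGraph V) (A : Set V) :
    2 * numEdges (G.induce A) = ∑ x ∈ A.toFinset, deg G A x := by
  rw [two_mul_numEdges, ← Finset.sum_set_coe]
  exact sum_congr rfl fun x _ => degree_induce G A x

lemma sum_min_deg_le {G : SimpleGraph V} {A : Set V} {D b : ℕ} (hD : ∀ x ∈ A, deg G A x ≤ D)
    (hb : b + 2 ≤ D) :
    ∑ x ∈ A.toFinset, min (deg G A x) b ≤ matchingNumber (G.induce A) * (D + b) := by
  refine le_trans (le_of_eq ?_) (sum_min_degree_le (H := G.induce A) (D := D) (b := b)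
    (fun x => (degree_induce G A x).trans_le (hD x x.2)) hb)
  rw [← Finset.sum_set_coe]
  exact sum_congr rfl fun x _ => congrArg (min · b) (degree_induce G A x).symm

/-- A graph with matching number `ν` and maximum degree at most `D` has at most `ν (D + 1)`
edges. -/
lemma numEdges_induce_le {G : SimpleGraph V} {A : Set V} {D : ℕ}
    (hD : ∀ x ∈ A, deg G A x ≤ D) :
    numEdges (G.induce A) ≤ matchingNumber (G.induce A) * (D + 1) := by
  have h := sum_min_deg_le (D := D + 2) (fun x hx => (hD x hx).trans (by omega)) le_rfl
  rw [sum_congr rfl fun x hx => min_eq_left (hD x (Set.mem_toFinset.1 hx)),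
    ← two_mul_numEdges_induce] at h
  linarith

/-! ### Non-adjacent pairs across the partition -/

/-- The vertices of `B` that are not adjacent to `v`. -/
noncomputable def nonNbrs (G : SimpleGraph V) (B : Set V) (v : V) : Finset V :=
  B.toFinset.filter fun u => ¬G.Adj v u

/-- The number of non-adjacent pairs in `A × B`. -/
noncomputable def missing (G : SimpleGraph V) (A B : Set V) : ℕ :=
  ∑ v ∈ A.toFinset, #(nonNbrs G B v)

lemma numEdges_between_add_missing (G : SimpleGraph V) {A B : Set V} (h : Disjoint A B) :
    numEdges (G.between A B) + missing G A B = A.ncard * B.ncard := by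
  have hb : (G.between A B).IsBipartiteWith (A.toFinset : Set V) (B.toFinset : Set V) := by
    simpa using between_isBipartiteWith h
  rw [numEdges, ← coe_edgeFinset, Set.ncard_coe_finset,
    ← isBipartiteWith_sum_degrees_eq_card_edges hb, missing, ← sum_add_distrib,
    Set.ncard_eq_toFinset_card' A, ← smul_eq_mul]
  refine sum_eq_card_nsmul fun v hv => ?_
  rw [Set.mem_toFinset] at hv
  have hvB : v ∉ B := Set.disjoint_left.1 h hv
  rw [← card_neighborFinset_eq_degree, nonNbrs, Set.ncard_eq_toFinset_card',
    ← card_filter_add_card_filter_not (s := B.toFinset) (fun u => G.Adj v u)]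
  congr 2
  ext u
  simp [between_adj, hv, hvB, and_comm]

lemma missing_comm (G : SimpleGraph V) {A B : Set V} (h : Disjoint A B) :
    missing G A B = missing G B A := by
  have h1 := numEdges_between_add_missing G h
  have h2 := numEdges_between_add_missing G h.symm
  rw [between_comm, mul_comm] at h2
  omega

/-- Every non-neighbour of `v` destroys at most one edge of a maximum matching of `G[B]`. -/
lemma matchingNumber_induce_le_add (G : SimpleGraph V) (B : Set V) (v : V) :
    matchingNumber (G.induce B) ≤
      matchingNumber (G.induce (nbrs G B v)) + #(nonNbrs G B v) := by
  obtain ⟨σ, hσ, hs⟩ := exists_isPairing_within G B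
  set p : V → Prop := fun x => x ∈ nbrs G B v ∧ σ x ∈ nbrs G B v
  set τ : V → V := fun x => if p x then σ x else x with hτdef
  have hτ₀ : IsPairing (within G B) τ :=
    hτdef ▸ hσ.restrict p fun x hx => ⟨hx.2, by rw [hσ.invol x]; exact hx.1⟩
  have hτ : IsPairing (within G (nbrs G B v)) τ := by
    refine ⟨hτ₀.invol, fun x hx => ?_⟩
    have hp : p x := by
      by_contra h
      exact hx (by simp [hτdef, h])
    refine ⟨(hτ₀.adj x hx).1, hp.1, ?_⟩
    simpa [hτdef, hp] using hp.2
  have hcov : moved σ ⊆ moved τ ∪ (nonNbrs G B v ∪ (nonNbrs G B v).image σ) := by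
    intro x hx
    rw [mem_moved] at hx
    have hadj := hσ.adj x hx
    by_cases hp : p x
    · exact mem_union_left _ (by simpa [hτdef, hp] using hx)
    refine mem_union_right _ ?_
    by_cases hxv : G.Adj v x
    · have hσx : ¬G.Adj v (σ x) := fun h => hp ⟨⟨hxv, hadj.2.1⟩, ⟨h, hadj.2.2⟩⟩
      exact mem_union_right _ (mem_image.2 ⟨σ x, by simp [nonNbrs, hσx, hadj.2.2], hσ.invol x⟩)
    · exact mem_union_left _ (by simp [nonNbrs, hxv, hadj.2.1])
  have h1 := (card_le_card hcov).trans (card_union_le _ _)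
  have h2 := card_union_le (nonNbrs G B v) ((nonNbrs G B v).image σ)
  have h3 : #((nonNbrs G B v).image σ) ≤ _ := card_image_le
  have h4 := card_moved_le_of_within hτ
  omega

/-! ### The excluded subgraphs -/

lemma starEdges_isContained {W : Type*} {H : SimpleGraph W} {m ℓ : ℕ} (x : W) (g : Fin m → W)
    (hg : Function.Injective g) (hx : ∀ i, H.Adj x (g i)) (p : Fin ℓ × Fin 2 → W)
    (hp : Function.Injective p) (hpp : ∀ j, H.Adj (p (j, 0)) (p (j, 1)))
    (hpx : ∀ q, p q ≠ x) (hpg : ∀ q i, p q ≠ g i) : (starEdges m ℓ).IsContained H := by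
  refine ⟨⟨⟨Sum.elim (Fin.cons x g : Fin (m + 1) → W) p, ?_⟩, ?_⟩⟩
  · rintro (a | ⟨j, a⟩) (b | ⟨j', b⟩) h
    · have h' : (star m).Adj a b := h
      rw [star, starGraph_adj] at h'
      obtain ⟨hne, rfl | rfl⟩ := h'
      · obtain ⟨b, rfl⟩ := Fin.exists_succ_eq.2 hne.symm
        simpa using hx b
      · obtain ⟨a, rfl⟩ := Fin.exists_succ_eq.2 hne
        simpa using (hx a).symm
    · simp [starEdges] at h
    · simp [starEdges] at h
    · have h' : (edges ℓ).Adj (j, a) (j', b) := h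
      obtain ⟨h1, h2⟩ := h'
      simp only at h1 h2
      subst h1
      fin_cases a <;> fin_cases b
      · exact absurd rfl h2
      · exact hpp j
      · exact (hpp j).symm
      · exact absurd rfl h2
  · refine Function.Injective.sumElim (Fin.cons_injective_iff.2 ⟨?_, hg⟩) hp fun a q => ?_
    · rintro ⟨i, hi⟩
      exact (hx i).ne hi.symm
    · refine Fin.cases ?_ (fun i => ?_) a
      · exact (hpx q).symm
      · exact (hpg q i).symm

/-- `S_1 ∪ K K₂` is a matching with `K + 1` edges. -/
lemma matchingNumber_le_of_free {W : Type*} [Finite W] {H : SimpleGraph W} {K : ℕ}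
    (h : (starEdges 1 K).Free H) : matchingNumber H ≤ K := by
  by_contra! hlt
  obtain ⟨M, hM, hc⟩ := (matchingNumber_isGreatest H).1
  have := Fintype.ofFinite M.edgeSet
  have hcard : Fintype.card (Fin (K + 1)) ≤ Fintype.card M.edgeSet := by
    rw [Fintype.card_fin, ← Nat.card_eq_fintype_card, Nat.card_coe_set_eq]
    omega
  obtain ⟨e⟩ := Function.Embedding.nonempty_of_card_le hcard
  have hab : ∀ j, ∃ a b, (e j : Sym2 W) = s(a, b) ∧ M.Adj a b := by
    intro j
    obtain ⟨⟨a, b⟩, hq⟩ := Quot.exists_rep (e j : Sym2 W)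
    exact ⟨a, b, hq.symm, Subgraph.mem_edgeSet.1 (by have := (e j).2; rw [← hq] at this; exact this)⟩
  choose a b hs hadj using hab
  have hedge : ∀ {i j u v w}, (e i : Sym2 W) = s(u, v) → (e j : Sym2 W) = s(u, w) →
      M.Adj u v → M.Adj u w → i = j := by
    intro i j u v w h1 h2 h3 h4
    rw [hM.eq_of_adj_left h3 h4, ← h2] at h1
    exact e.injective (Subtype.ext h1)
  have haa : ∀ i j, a i = a j → i = j := fun i j h =>
    hedge (hs i) (by rw [h]; exact hs j) (hadj i) (by rw [h]; exact hadj j)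
  have hbb : ∀ i j, b i = b j → i = j := fun i j h =>
    hedge (u := b i) (v := a i) (w := a j) (by rw [hs i, Sym2.eq_swap])
      (by rw [hs j, h, Sym2.eq_swap]) (hadj i).symm (by rw [h]; exact (hadj j).symm)
  have habne : ∀ i j, a i ≠ b j := by
    intro i j h
    have hij : i = j := hedge (w := a j) (hs i) (by rw [h, hs j, Sym2.eq_swap]) (hadj i)
      (by rw [h]; exact (hadj j).symm)
    subst hij
    exact (hadj i).ne h
  refine h (starEdges_isContained (a (Fin.last K)) (fun _ => b (Fin.last K))
    (fun _ _ _ => Subsingleton.elim _ _) (fun _ => M.adj_sub (hadj _))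
    (fun q => if q.2 = 0 then a q.1.castSucc else b q.1.castSucc) ?_ ?_ ?_ ?_)
  · rintro ⟨i, s⟩ ⟨j, t⟩ hst
    fin_cases s <;> fin_cases t <;> simp at hst
    · simpa using haa _ _ hst
    · exact absurd hst (habne _ _)
    · exact absurd hst.symm (habne _ _)
    · simpa using hbb _ _ hst
  · intro j
    simpa using M.adj_sub (hadj j.castSucc)
  · rintro ⟨j, s⟩ hq
    fin_cases s <;> simp at hq
    · exact (Fin.castSucc_lt_last j).ne (haa _ _ hq)
    · exact habne _ _ hq.symm
  · rintro ⟨j, s⟩ - hq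
    fin_cases s <;> simp at hq
    · exact habne _ _ hq
    · exact (Fin.castSucc_lt_last j).ne (hbb _ _ hq)

lemma degree_lt_of_free {H : SimpleGraph V} {k : ℕ} (h : (starEdges k 0).Free H) (x : V) :
    H.degree x < k := by
  by_contra! hle
  rw [← card_neighborFinset_eq_degree, ← Fintype.card_fin k, ← Fintype.card_coe] at hle
  obtain ⟨e⟩ := Function.Embedding.nonempty_of_card_le hle
  exact h (starEdges_isContained x (fun i => (e i : V))
    (fun _ _ hij => e.injective (Subtype.ext hij))
    (fun i => (H.mem_neighborFinset _ _).1 (e i).2) (fun q => q.1.elim0)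
    (fun q => q.1.elim0) (fun q => q.elim0) (fun q => q.1.elim0) (fun q => q.1.elim0))

lemma adj_or_adj_of_free {H : SimpleGraph V} {K : ℕ} (h : (starEdges K 1).Free H) {x u w : V}
    (hx : H.degree x = K) (huw : H.Adj u w) : H.Adj x u ∨ H.Adj x w := by
  by_contra! hcon
  rw [← card_neighborFinset_eq_degree, ← Fintype.card_coe] at hx
  have e := (Fintype.equivFinOfCardEq hx).symm
  have he : ∀ i, H.Adj x (e i) := fun i => (H.mem_neighborFinset _ _).1 (e i).2
  refine h (starEdges_isContained x (fun i => (e i : V))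
    (fun _ _ hij => e.injective (Subtype.ext hij)) he
    (fun q => if q.2 = 0 then u else w) ?_ ?_ ?_ ?_)
  · rintro ⟨i, s⟩ ⟨j, t⟩ hst
    obtain rfl := Subsingleton.elim i j
    fin_cases s <;> fin_cases t <;> simp at hst ⊢
    · exact huw.ne hst
    · exact huw.ne hst.symm
  · intro j
    simpa using huw
  · rintro ⟨j, s⟩ hq
    fin_cases s <;> simp at hq
    · exact hcon.2 (hq ▸ huw)
    · exact hcon.1 (hq ▸ huw.symm)
  · rintro ⟨j, s⟩ i hq
    fin_cases s <;> simp at hq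
    · exact hcon.1 (hq ▸ he i)
    · exact hcon.2 (hq ▸ he i)

/-! ### The extremal function -/

lemma numEdges_le_f {H : SimpleGraph V} {ν D : ℕ} (hν : matchingNumber H ≤ ν)
    (hD : ∀ x, H.degree x ≤ D) : numEdges H ≤ f ν D := by
  let e := Fintype.equivFin V
  let φ : H ≃g H.map e.toEmbedding := Iso.map e H
  obtain ⟨σ, hσ, hs⟩ := exists_isPairing_card_eq (H.map e.toEmbedding)
  have hτ : IsPairing H (fun x => φ.symm (σ (φ x))) := by
    refine ⟨fun x => by simp [hσ.invol (φ x)], fun x hx => ?_⟩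
    have := hσ.adj (φ x) fun h => hx (by rw [h]; simp)
    simpa using φ.symm.map_adj_iff.2 this
  have hcard : #(moved σ) = #(moved fun x => φ.symm (σ (φ x))) := by
    refine card_bij (fun y _ => φ.symm y) (fun y hy => ?_) (fun _ _ _ _ h => φ.symm.injective h)
      fun x hx => ⟨φ x, ?_, by simp⟩
    · simpa using hy
    · rw [mem_moved] at hx ⊢
      exact fun h => hx (by rw [h]; simp)
  refine (f_isGreatest ν D).2 ⟨Fintype.card V, H.map e.toEmbedding, inferInstance, ?_, ?_, ?_⟩
  · have := hτ.card_le
    omega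
  · refine maxDegree_le_of_forall_degree_le _ _ fun y => ?_
    obtain ⟨x, rfl⟩ := φ.surjective y
    refine le_trans (le_of_eq ?_) (hD x)
    convert φ.degree_eq x
  · rw [numEdges, numEdges, edgeSet_map, Set.ncard_image_of_injective _ (Function.Embedding.injective _)]

/-- The complete bipartite graph with parts of size `K` shows `f(K, K) ≥ K²`. -/
lemma sq_le_f (K : ℕ) : K ^ 2 ≤ f K K := by
  have hdeg : ∀ x, (completeBipartiteGraph (Fin K) (Fin K)).degree x = K := by
    intro x
    rw [← card_neighborFinset_eq_degree]
    rcases x with i | i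
    · have : (completeBipartiteGraph (Fin K) (Fin K)).neighborFinset (Sum.inl i) =
          univ.map Function.Embedding.inr := by
        ext y; rcases y with y | y <;> simp
      simp [this]
    · have : (completeBipartiteGraph (Fin K) (Fin K)).neighborFinset (Sum.inr i) =
          univ.map Function.Embedding.inl := by
        ext y; rcases y with y | y <;> simp
      simp [this]
  have hν : matchingNumber (completeBipartiteGraph (Fin K) (Fin K)) ≤ K := by
    obtain ⟨σ, -, hs⟩ := exists_isPairing_card_eq (completeBipartiteGraph (Fin K) (Fin K))
    have := card_le_univ (moved σ)
    rw [Fintype.card_sum, Fintype.card_fin] at this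
    omega
  have h := numEdges_le_f hν fun x => (hdeg x).le
  have h2 := two_mul_numEdges (completeBipartiteGraph (Fin K) (Fin K))
  simp only [hdeg, sum_const, card_univ, Fintype.card_sum, Fintype.card_fin, smul_eq_mul] at h2
  nlinarith

/-- The disjoint union of `G[A]` and `G[B]` is an admissible graph for `f(ν, D)`. -/
lemma numEdges_induce_add_le_f {G : SimpleGraph V} {A B : Set V} (hAB : Disjoint A B) {ν D : ℕ}
    (hν : matchingNumber (G.induce A) + matchingNumber (G.induce B) ≤ ν)
    (hA : ∀ x ∈ A, deg G A x ≤ D) (hB : ∀ x ∈ B, deg G B x ≤ D) :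
    numEdges (G.induce A) + numEdges (G.induce B) ≤ f ν D := by
  obtain ⟨H, hH⟩ : ∃ H, H = within G A ⊔ within G B := ⟨_, rfl⟩
  have hadj : ∀ x y, H.Adj x y ↔ G.Adj x y ∧ (x ∈ A ∧ y ∈ A ∨ x ∈ B ∧ y ∈ B) := by
    intro x y
    rw [hH, sup_adj]
    simp only [within]
    tauto
  have hdeg : ∀ x, H.degree x =
      (if x ∈ A then deg G A x else 0) + if x ∈ B then deg G B x else 0 := by
    intro x
    rw [← card_neighborFinset_eq_degree]
    by_cases hxA : x ∈ A
    · have hxB : x ∉ B := Set.disjoint_left.1 hAB hxA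
      rw [if_pos hxA, if_neg hxB, add_zero, deg_eq_card]
      congr 1
      ext y; simp [hadj, hxA, hxB]
    by_cases hxB : x ∈ B
    · rw [if_neg hxA, if_pos hxB, zero_add, deg_eq_card]
      congr 1
      ext y; simp [hadj, hxA, hxB]
    · rw [if_neg hxA, if_neg hxB, card_eq_zero]
      ext y; simp [hadj, hxA, hxB]
  have hνH : matchingNumber H ≤ ν := by
    obtain ⟨σ, hσ, hs⟩ := exists_isPairing_card_eq H
    have hcl : ∀ C : Set V, C = A ∨ C = B → ∀ x ∈ C, σ x ∈ C := by
      intro C hC x hx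
      by_cases h : σ x = x
      · rwa [h]
      have h1 := ((hadj _ _).1 (hσ.adj x h)).2
      have h2 := fun y (h : y ∈ A) (h' : y ∈ B) => Set.disjoint_left.1 hAB h h'
      rcases hC with rfl | rfl
      · rcases h1 with h1 | h1
        · exact h1.2
        · exact absurd h1.1 (h2 x hx)
      · rcases h1 with h1 | h1
        · exact absurd hx (h2 x h1.1)
        · exact h1.2
    have hpair : ∀ C : Set V, C = A ∨ C = B →
        IsPairing (within G C) (fun x => if x ∈ C then σ x else x) := by
      intro C hC
      have h := hσ.restrict (· ∈ C) (hcl C hC)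
      refine ⟨h.invol, fun x hx => ?_⟩
      have hxC : x ∈ C := by
        by_contra hxC
        exact hx (by simp [hxC])
      refine ⟨((hadj _ _).1 (h.adj x hx)).1, hxC, ?_⟩
      simpa [hxC] using hcl C hC x hxC
    have hcov : moved σ ⊆ moved (fun x => if x ∈ A then σ x else x) ∪
        moved (fun x => if x ∈ B then σ x else x) := by
      intro x hx
      rw [mem_moved] at hx
      rcases ((hadj _ _).1 (hσ.adj x hx)).2 with h | h
      · exact mem_union_left _ (by simpa [h.1] using hx)
      · exact mem_union_right _ (by simpa [h.1] using hx)
    have h1 := (card_le_card hcov).trans (card_union_le _ _)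
    have h2 := card_moved_le_of_within (hpair A (Or.inl rfl))
    have h3 := card_moved_le_of_within (hpair B (Or.inr rfl))
    omega
  have hDH : ∀ x, H.degree x ≤ D := by
    intro x
    rw [hdeg]
    by_cases hxA : x ∈ A
    · simpa [hxA, Set.disjoint_left.1 hAB hxA] using hA x hxA
    by_cases hxB : x ∈ B
    · simpa [hxA, hxB] using hB x hxB
    · simp [hxA, hxB]
  have h := numEdges_le_f hνH hDH
  have h2 := two_mul_numEdges H
  simp only [hdeg, sum_add_distrib] at h2
  rw [← sum_filter, ← sum_filter] at h2
  have hAe := two_mul_numEdges_induce G A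
  have hBe := two_mul_numEdges_induce G B
  rw [Set.filter_mem_univ_eq_toFinset, Set.filter_mem_univ_eq_toFinset] at h2
  omega

/-! ### Weighing edges against non-adjacent pairs -/

/-- Each vertex of `A` pays, with its non-neighbours in `B`, for its degree in excess of
`K - ν(G[B])`; the remaining truncated degrees are few by `sum_min_deg_le`. -/
lemma two_mul_numEdges_le_missing_add {G : SimpleGraph V} {A B : Set V} {K : ℕ}
    (hK : ∀ x ∈ A, deg G A x ≤ K)
    (hm : ∀ x ∈ A, deg G A x + matchingNumber (G.induce B) ≤ K + #(nonNbrs G B x))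
    (h2 : 2 ≤ matchingNumber (G.induce B)) (hB : matchingNumber (G.induce B) ≤ K) :
    2 * numEdges (G.induce A) ≤ missing G A B +
      matchingNumber (G.induce A) * (K + (K - matchingNumber (G.induce B))) := by
  have h := sum_min_deg_le (b := K - matchingNumber (G.induce B)) hK (by omega)
  refine le_trans ?_ (Nat.add_le_add_left h _)
  rw [two_mul_numEdges_induce, missing, ← sum_add_distrib]
  refine sum_le_sum fun x hx => ?_
  have := hm x (Set.mem_toFinset.1 hx)
  omega

lemma two_mul_numEdges_le_missing {G : SimpleGraph V} {A B : Set V} {K : ℕ}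
    (hm : ∀ x ∈ A, deg G A x + matchingNumber (G.induce B) ≤ K + #(nonNbrs G B x))
    (hB : matchingNumber (G.induce B) = K) :
    2 * numEdges (G.induce A) ≤ missing G A B := by
  rw [two_mul_numEdges_induce, missing]
  refine sum_le_sum fun x hx => ?_
  have := hm x (Set.mem_toFinset.1 hx)
  omega

/-- If both induced subgraphs have matching number at least `2`, averaging the bounds of the two
sides leaves at most `K² - (K - ν(G[A])) (K - ν(G[B]))`. -/
lemma numEdges_add_le_sq_add_missing_of_two_le {G : SimpleGraph V} {A B : Set V}
    (hAB : Disjoint A B) {K : ℕ}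
    (hKA : ∀ x ∈ A, deg G A x ≤ K) (hKB : ∀ x ∈ B, deg G B x ≤ K)
    (hmA : ∀ x ∈ A, deg G A x + matchingNumber (G.induce B) ≤ K + #(nonNbrs G B x))
    (hmB : ∀ x ∈ B, deg G B x + matchingNumber (G.induce A) ≤ K + #(nonNbrs G A x))
    (hA : matchingNumber (G.induce A) ≤ K) (hB : matchingNumber (G.induce B) ≤ K)
    (h2A : 2 ≤ matchingNumber (G.induce A)) (h2B : 2 ≤ matchingNumber (G.induce B)) :
    numEdges (G.induce A) + numEdges (G.induce B) ≤ K ^ 2 + missing G A B := by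
  have h1 := two_mul_numEdges_le_missing_add hKA hmA h2B hB
  have h2 := two_mul_numEdges_le_missing_add hKB hmB h2A hA
  rw [← missing_comm G hAB] at h2
  obtain ⟨a, ha⟩ := Nat.exists_eq_add_of_le hA
  obtain ⟨b, hb⟩ := Nat.exists_eq_add_of_le hB
  have ha' : K - matchingNumber (G.induce A) = a := by omega
  have hb' : K - matchingNumber (G.induce B) = b := by omega
  rw [hb'] at h1
  rw [ha'] at h2
  generalize matchingNumber (G.induce A) = p at *
  generalize matchingNumber (G.induce B) = q at *
  have e1 : p * (K + b) + q * (K + a) + 2 * (a * b) = 2 * K ^ 2 := by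
    zify at ha hb ⊢
    rw [eq_sub_of_add_eq ha.symm, eq_sub_of_add_eq hb.symm]
    ring
  linarith [Nat.zero_le (a * b)]

/-- If `v` has degree `K` in `G[A]`, its neighbours meet all edges of `G[A]`, and `v` has no
neighbour among the endpoints of edges of `G[B]`. -/
lemma numEdges_add_le_sq_add_missing_of_deg_eq {G : SimpleGraph V} {A B : Set V} {K : ℕ} {v : V}
    (hv : v ∈ A) (hd : deg G A v = K)
    (hKB : ∀ x ∈ B, deg G B x ≤ K)
    (hmA : ∀ x ∈ A, deg G A x + matchingNumber (G.induce B) ≤ K + #(nonNbrs G B x))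
    (hfree : (starEdges K 1).Free (G.induce A))
    (hiso : ∀ u : B, G.Adj v u → (G.induce B).IsIsolated u) :
    numEdges (G.induce A) + numEdges (G.induce B) ≤ K ^ 2 + missing G A B := by
  have hdeg : (G.induce A).degree ⟨v, hv⟩ = K := (degree_induce G A ⟨v, hv⟩).trans hd
  set N := (G.induce A).neighborFinset ⟨v, hv⟩ with hN
  have hNc : #N = K := by rw [hN, card_neighborFinset_eq_degree, hdeg]
  have hcov : (G.induce A).edgeFinset ⊆ N.biUnion fun u => (G.induce A).incidenceFinset u := by
    intro e he
    induction e with | _ x y => ?_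
    have hxy : (G.induce A).Adj x y := by simpa using he
    simp only [mem_biUnion, hN, mem_neighborFinset, mem_incidenceFinset]
    rcases adj_or_adj_of_free hfree hdeg hxy with h | h
    · exact ⟨x, h, hxy, by simp⟩
    · exact ⟨y, h, hxy, by simp⟩
  have heA : numEdges (G.induce A) ≤ ∑ u ∈ N, deg G A u := by
    rw [numEdges, ← coe_edgeFinset, Set.ncard_coe_finset]
    refine (card_le_card hcov).trans (card_biUnion_le.trans (sum_le_sum fun u _ => ?_))
    rw [card_incidenceFinset_eq_degree]
    exact (degree_induce G A u).le
  have hsum : ∑ u ∈ N, deg G A u + K * matchingNumber (G.induce B) ≤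
      K * K + ∑ u ∈ N, #(nonNbrs G B u) := by
    have h := sum_le_sum fun u (_ : u ∈ N) => hmA u u.2
    simpa [sum_add_distrib, hNc] using h
  have hmiss : ∑ u ∈ N, #(nonNbrs G B u) + #(nonNbrs G B v) ≤ missing G A B := by
    have hvN : (⟨v, hv⟩ : A) ∉ N := by simp [hN]
    rw [missing, ← Finset.sum_set_coe, add_comm,
      ← sum_insert (f := fun u : A => #(nonNbrs G B u)) hvN]
    exact sum_le_sum_of_subset (subset_univ _)
  have hmv : 2 * matchingNumber (G.induce B) ≤ #(nonNbrs G B v) := by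
    obtain ⟨σ, hσ, hs⟩ := exists_isPairing_within G B
    rw [← hs]
    refine card_le_card fun x hx => ?_
    obtain ⟨h1, h2, h3⟩ := hσ.adj x (mem_moved.1 hx)
    simp only [nonNbrs, mem_filter, Set.mem_toFinset]
    exact ⟨h2, fun h => hiso ⟨x, h2⟩ h ⟨σ x, h3⟩ h1⟩
  have heB := numEdges_induce_le hKB
  nlinarith

/-- The case `ν(G[B]) ≤ 1`, relative to a bound `F` valid for `G[A]` alone and for
the two parts together when `ν(G[A]) + ν(G[B]) ≤ K`. -/
lemma numEdges_add_le_add_missing_of_le_one {G : SimpleGraph V} {A B : Set V}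
    (hAB : Disjoint A B) {K F : ℕ}
    (hmB : ∀ x ∈ B, deg G B x + matchingNumber (G.induce A) ≤ K + #(nonNbrs G A x))
    (hA : matchingNumber (G.induce A) ≤ K) (hB : matchingNumber (G.induce B) ≤ 1)
    (hF : numEdges (G.induce A) ≤ F)
    (hFF : matchingNumber (G.induce A) + matchingNumber (G.induce B) ≤ K →
      numEdges (G.induce A) + numEdges (G.induce B) ≤ F) :
    numEdges (G.induce A) + numEdges (G.induce B) ≤ F + missing G A B := by
  by_cases h : matchingNumber (G.induce A) + matchingNumber (G.induce B) ≤ K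
  · exact (hFF h).trans (Nat.le_add_right _ _)
  · have := two_mul_numEdges_le_missing hmB (by omega)
    rw [← missing_comm G hAB] at this
    omega

/-- The previous cases combined, for a bound `F ≥ K²`. -/
lemma numEdges_add_le_add_missing {G : SimpleGraph V} {A B : Set V}
    (hAB : Disjoint A B) {K F : ℕ}
    (hKA : ∀ x ∈ A, deg G A x ≤ K) (hKB : ∀ x ∈ B, deg G B x ≤ K)
    (hmA : ∀ x ∈ A, deg G A x + matchingNumber (G.induce B) ≤ K + #(nonNbrs G B x))
    (hmB : ∀ x ∈ B, deg G B x + matchingNumber (G.induce A) ≤ K + #(nonNbrs G A x))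
    (hA : matchingNumber (G.induce A) ≤ K) (hB : matchingNumber (G.induce B) ≤ K)
    (hF : K ^ 2 ≤ F) (hFA : numEdges (G.induce A) ≤ F) (hFB : numEdges (G.induce B) ≤ F)
    (hFF : matchingNumber (G.induce A) + matchingNumber (G.induce B) ≤ K →
      numEdges (G.induce A) + numEdges (G.induce B) ≤ F) :
    numEdges (G.induce A) + numEdges (G.induce B) ≤ F + missing G A B := by
  by_cases h1 : matchingNumber (G.induce B) ≤ 1
  · exact numEdges_add_le_add_missing_of_le_one hAB hmB hA h1 hFA hFF
  by_cases h2 : matchingNumber (G.induce A) ≤ 1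
  · rw [missing_comm G hAB, add_comm (numEdges (G.induce A))]
    refine numEdges_add_le_add_missing_of_le_one hAB.symm hmA hB h2 hFB fun h => ?_
    rw [add_comm]
    exact hFF (by omega)
  · have := numEdges_add_le_sq_add_missing_of_two_le hAB hKA hKB hmA hmB hA hB (by omega) (by omega)
    omega

end StarMatching

open StarMatching in
theorem lemma4 {V : Type*} [Finite V] (G : SimpleGraph V) (P : Fin 2 → Set V)
    (hdisj : Disjoint (P 0) (P 1)) (hunion : P 0 ∪ P 1 = Set.univ)
    (k k₁ : ℕ) (hk : 1 ≤ k) (hk₁ : k₁ ≤ k)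
    (h1 : ∀ i : Fin 2, ∀ ℓ : ℕ, ((ℓ + k₁ ≤ k ∧ ℓ + 2 ≤ k) ∨ ℓ + 1 = k) →
      (starEdges (k - ℓ) ℓ).Free (G.induce (P i)))
    (h2 : ∀ i : Fin 2, ∀ v ∈ P i,
      deg G (P i) v + matchingNumber (G.induce (nbrs G (P (1 - i)) v)) ≤ k - 1)
    (h3 : k₁ < k → ∀ i : Fin 2, ∀ v ∈ P i, deg G (P i) v = k - 1 →
      ∀ u : P (1 - i), G.Adj v u → (G.induce (P (1 - i))).IsIsolated u) :
    (k₁ < k →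
      (numEdges (G.induce (P 0)) : ℤ) + numEdges (G.induce (P 1))
        - (((P 0).ncard : ℤ) * (P 1).ncard - numEdges (G.between (P 0) (P 1)))
        ≤ ((k : ℤ) - 1) ^ 2) ∧
    (k = k₁ →
      (numEdges (G.induce (P 0)) : ℤ) + numEdges (G.induce (P 1))
        - (((P 0).ncard : ℤ) * (P 1).ncard - numEdges (G.between (P 0) (P 1)))
        ≤ f (k - 1) (k - 1)) := by
  classical
  have := Fintype.ofFinite V
  obtain ⟨K, rfl⟩ : ∃ K, k = K + 1 := ⟨k - 1, by omega⟩
  simp only [Nat.add_sub_cancel] at h2 h3 ⊢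
  have hν : ∀ i, matchingNumber (G.induce (P i)) ≤ K := fun i =>
    matchingNumber_le_of_free (by
      have h := h1 i K (Or.inr rfl)
      rwa [Nat.add_sub_cancel_left] at h)
  have hdeg : ∀ i, ∀ x ∈ P i, deg G (P i) x ≤ K := by
    intro i x hx
    exact Nat.le_of_lt_succ ((degree_induce G (P i) ⟨x, hx⟩).symm.trans_lt
      (degree_lt_of_free (h1 i 0 (by omega)) ⟨x, hx⟩))
  have hm : ∀ i, ∀ x ∈ P i, deg G (P i) x + matchingNumber (G.induce (P (1 - i))) ≤
      K + (nonNbrs G (P (1 - i)) x).card := by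
    intro i x hx
    have h := h2 i x hx
    have h' := matchingNumber_induce_le_add G (P (1 - i)) x
    omega
  have hmiss := numEdges_between_add_missing G hdisj
  have hm0 : ∀ x ∈ P 0, deg G (P 0) x + matchingNumber (G.induce (P 1)) ≤
      K + (nonNbrs G (P 1) x).card := hm 0
  have hm1 : ∀ x ∈ P 1, deg G (P 1) x + matchingNumber (G.induce (P 0)) ≤
      K + (nonNbrs G (P 0) x).card := hm 1
  -- The subtracted number of non-edges is `missing G (P 0) (P 1)`.
  have hcast : ∀ F : ℕ, numEdges (G.induce (P 0)) + numEdges (G.induce (P 1)) ≤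
      F + missing G (P 0) (P 1) →
      (numEdges (G.induce (P 0)) : ℤ) + numEdges (G.induce (P 1))
        - (((P 0).ncard : ℤ) * (P 1).ncard - numEdges (G.between (P 0) (P 1))) ≤ F := by
    intro F hF
    zify at hmiss hF
    linarith
  refine ⟨fun hlt => ?_, fun _ => hcast _ ?_⟩
  · have hgoal : numEdges (G.induce (P 0)) + numEdges (G.induce (P 1)) ≤
        K ^ 2 + missing G (P 0) (P 1) := by
      obtain rfl | hKpos := Nat.eq_zero_or_pos K
      · have he : ∀ i, numEdges (G.induce (P i)) ≤ 0 := fun i => by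
          simpa [Nat.le_zero.1 (hν i)] using numEdges_induce_le (hdeg i)
        have := he 0
        have := he 1
        omega
      have hfree : ∀ i, (starEdges K 1).Free (G.induce (P i)) := fun i => by
        simpa using h1 i 1 (by omega)
      by_cases h0 : ∃ v ∈ P 0, deg G (P 0) v = K
      · obtain ⟨v, hv, hd⟩ := h0
        exact numEdges_add_le_sq_add_missing_of_deg_eq hv hd (hdeg 1) hm0 (hfree 0)
          (h3 hlt 0 v hv hd)
      by_cases h1 : ∃ v ∈ P 1, deg G (P 1) v = K
      · obtain ⟨v, hv, hd⟩ := h1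
        rw [missing_comm G hdisj, add_comm (numEdges _)]
        exact numEdges_add_le_sq_add_missing_of_deg_eq hv hd (hdeg 0) hm1 (hfree 1)
          (h3 hlt 1 v hv hd)
      push Not at h0 h1
      -- All degrees are at most `K - 1`, so each part has at most `ν K` edges.
      have he0 := numEdges_induce_le (G := G) (A := P 0) (D := K - 1) fun x hx => by
        have := hdeg 0 x hx; have := h0 x hx; omega
      have he1 := numEdges_induce_le (G := G) (A := P 1) (D := K - 1) fun x hx => by
        have := hdeg 1 x hx; have := h1 x hx; omega
      rw [Nat.sub_add_cancel hKpos] at he0 he1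
      refine numEdges_add_le_add_missing hdisj (hdeg 0) (hdeg 1) hm0 hm1 (hν 0) (hν 1) le_rfl
        (he0.trans ?_) (he1.trans ?_) fun h => (add_le_add he0 he1).trans ?_
      · rw [sq]; exact Nat.mul_le_mul_right _ (hν 0)
      · rw [sq]; exact Nat.mul_le_mul_right _ (hν 1)
      · rw [sq, ← add_mul]; exact Nat.mul_le_mul_right _ h
    have := hcast _ hgoal
    push_cast at this ⊢
    simpa using this
  · have hf : ∀ i, numEdges (G.induce (P i)) ≤ f K K := fun i =>
      numEdges_le_f (hν i) fun x => (degree_induce G (P i) x).trans_le (hdeg i x x.2)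
    exact numEdges_add_le_add_missing hdisj (hdeg 0) (hdeg 1) hm0 hm1 (hν 0) (hν 1) (sq_le_f K)
      (hf 0) (hf 1) fun h => numEdges_induce_add_le_f hdisj h (hdeg 0) (hdeg 1)
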